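/- Let $\Bbbk$ be a field and let $(V,c)$ be a finite-dimensional braided vector space, i.e. $c\in\mathrm{End}_\Bbbk(V\otimes V)$ is invertible and $c_{12}c_{23}c_{12}=c_{23}c_{12}c_{23}$ on $V^{\otimes 3}$. Fix a basis $(v_i)_{1\le i\le N}$ of $V$ and write $c(v_i\otimes v_j)=\sum_{k,\ell}c_{ij}^{k\ell}\,v_k\otimes v_\ell$. Let $A(c)$ be the FRT bialgebra: the quotient of the free algebra $\Bbbk\{T_i^j\}_{1\le i,j\le N}$ by the two-sided ideal generated by the elements $\sum_{m,n}(c_{ij}^{mn}T_m^kT_n^\ell-T_i^mT_j^nc_{mn}^{k\ell})$, with $\Delta(T_i^j)=\sum_sT_i^s\otimes T_s^j$ and $\varepsilon(T_i^j)=\delta_i^j$. Let $\mathcal R\colon A(c)\otimes A(c)\to\Bbbk$ be its coquasitriangular structure, determined by $\mathcal R(T_i^k\otimes T_j^\ell)=c_{ji}^{k\ell}$; that is, $\mathcal R$ is invertible for the convolution product $*$ and satisfies $\mathcal R*m=m^{\mathrm{op}}*\mathcal R$, $\mathcal R(\mathrm{Id}\otimes m)=\mathcal R_{13}*\mathcal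 R_{12}$ and $\mathcal R(m\otimes\mathrm{Id})=\mathcal R_{13}*\mathcal R_{23}$, where $m$ is the multiplication and scalar-valued maps are regarded as $A(c)$-valued through the unit where needed. Then there is a linear map $\partial\colon A(c)\to\Bbbk$ with $\partial(T_{i_1}^{j_1}\cdots T_{i_m}^{j_m})=m\,\varepsilon(T_{i_1}^{j_1}\cdots T_{i_m}^{j_m})$ for all monomials, and it is a derivation: $\partial(xy)=\partial(x)\varepsilon(y)+\varepsilon(x)\partial(y)$. For every $\lambda\in\Bbbk$, the linear map $\chi_\lambda:=\lambda\,\partial\otimes\partial\colon A(c)\otimes A(c)\to\Bbbk$ is given on monomials by $$\chi_\lambda(T_{i_1}^{j_1}\cdots T_{i_m}^{j_m}\otimes T_{k_1}^{\ell_1}\cdots T_{k_n}^{\ell_n})=\lambda\,mn\,\varepsilon(T_{i_1}^{j_1}\cdots T_{i_m}^{j_m}T_{k_1}^{\ell_1}\cdots T_{k_n}^{\ell_n}),$$ and it is an infinitesimal $\mathcal R$-form, i.e. $\chi=\chi_\lambda$ satisfies $$\chi*m=m*\chi,\qquad \chi(\mathrm{Id}\otimes m)=\chi_{12}+\mathcal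 R_{12}^{-1}*\chi_{13}*\mathcal R_{12},\qquad \chi(m\otimes\mathrm{Id})=\chi_{23}+\mathcal R_{23}^{-1}*\chi_{13}*\mathcal R_{23}.$$ Moreover $(A(c),\mathcal R,\chi_\lambda)$ is Cartier, i.e. in addition $\mathcal R*\chi_\lambda=\chi_\lambda^{\mathrm{op}}*\mathcal R$, where $\chi^{\mathrm{op}}=\chi\circ\tau$ with $\tau$ the flip. -/

import Mathlib

open TensorProduct WithConv

noncomputable section

/-! ### Convolution notions: coquasitriangular, pre-Cartier and Cartier bialgebras -/

namespace Cartier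

variable {k H : Type*} [Field k] [Ring H] [Bialgebra k H]

/-- `f₁₂ = f ⊗ ε` on `H ⊗ H ⊗ H`. -/
def leg12 (f : H ⊗[k] H →ₗ[k] k) : (H ⊗[k] H) ⊗[k] H →ₗ[k] k :=
  LinearMap.mul' k k ∘ₗ TensorProduct.map f (Coalgebra.counit (R := k) (A := H))

/-- `f₂₃ = ε ⊗ f` on `H ⊗ H ⊗ H`. -/
def leg23 (f : H ⊗[k] H →ₗ[k] k) : (H ⊗[k] H) ⊗[k] H →ₗ[k] k :=
  LinearMap.mul' k k ∘ₗ TensorProduct.map (Coalgebra.counit (R := k) (A := H)) f ∘ₗ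
    (TensorProduct.assoc k H H H).toLinearMap

/-- `f₁₃ = (ε ⊗ f) ∘ (τ ⊗ id)` on `H ⊗ H ⊗ H`. -/
def leg13 (f : H ⊗[k] H →ₗ[k] k) : (H ⊗[k] H) ⊗[k] H →ₗ[k] k :=
  leg23 f ∘ₗ LinearMap.rTensor H (TensorProduct.comm k H H).toLinearMap

/-- `f^op = f ∘ τ`. -/
def flip {M : Type*} [AddCommGroup M] [Module k M] (f : H ⊗[k] H →ₗ[k] M) : H ⊗[k] H →ₗ[k] M :=
  f ∘ₗ (TensorProduct.comm k H H).toLinearMap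

/-- `u_H ∘ f`, a scalar-valued map regarded as `H`-valued. -/
def unitComp (f : H ⊗[k] H →ₗ[k] k) : H ⊗[k] H →ₗ[k] H :=
  Algebra.linearMap k H ∘ₗ f

/-- `id ⊗ m` on `H ⊗ H ⊗ H`. -/
def idMul : (H ⊗[k] H) ⊗[k] H →ₗ[k] H ⊗[k] H :=
  LinearMap.lTensor H (LinearMap.mul' k H) ∘ₗ (TensorProduct.assoc k H H H).toLinearMap

/-- `m ⊗ id` on `H ⊗ H ⊗ H`. -/
def mulId : (H ⊗[k] H) ⊗[k] H →ₗ[k] H ⊗[k] H :=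
  LinearMap.rTensor H (LinearMap.mul' k H)

/-- The inverse of a linear form on `H ⊗ H` for the convolution product
(used only for convolution-invertible forms). -/
def convInv (f : H ⊗[k] H →ₗ[k] k) : H ⊗[k] H →ₗ[k] k :=
  (Ring.inverse (toConv f)).ofConv

/-- `R` is a universal `R`-form, i.e. `(H, R)` is a coquasitriangular bialgebra. All products
below are convolution products. -/
structure IsUniversalRForm (R : H ⊗[k] H →ₗ[k] k) : Prop where
  isUnit : IsUnit (toConv R)
  /-- `R * m = m^op * R` -/
  quasiComm : toConv (unitComp R) * toConv (LinearMap.mul' k H) =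
    toConv (flip (LinearMap.mul' k H)) * toConv (unitComp R)
  /-- `R (id ⊗ m) = R₁₃ * R₁₂` -/
  idMul_eq : toConv (R ∘ₗ idMul) = toConv (leg13 R) * toConv (leg12 R)
  /-- `R (m ⊗ id) = R₁₃ * R₂₃` -/
  mulId_eq : toConv (R ∘ₗ mulId) = toConv (leg13 R) * toConv (leg23 R)

/-- `χ` is an infinitesimal `R`-form for the coquasitriangular bialgebra `(H, R)`, i.e.
`(H, R, χ)` is a pre-Cartier coquasitriangular bialgebra. -/
structure IsInfinitesimalRForm (R χ : H ⊗[k] H →ₗ[k] k) : Prop where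
  isUniversalRForm : IsUniversalRForm R
  /-- `χ * m = m * χ` -/
  mul_comm : toConv (unitComp χ) * toConv (LinearMap.mul' k H) =
    toConv (LinearMap.mul' k H) * toConv (unitComp χ)
  /-- `χ (id ⊗ m) = χ₁₂ + R₁₂⁻¹ * χ₁₃ * R₁₂` -/
  idMul_eq : toConv (χ ∘ₗ idMul) =
    toConv (leg12 χ) + toConv (leg12 (convInv R)) * toConv (leg13 χ) * toConv (leg12 R)
  /-- `χ (m ⊗ id) = χ₂₃ + R₂₃⁻¹ * χ₁₃ * R₂₃` -/
  mulId_eq : toConv (χ ∘ₗ mulId) =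
    toConv (leg23 χ) + toConv (leg23 (convInv R)) * toConv (leg13 χ) * toConv (leg23 R)

/-- `(H, R, χ)` is a Cartier coquasitriangular bialgebra: it is pre-Cartier and
`R * χ = χ^op * R`. -/
structure IsCartier (R χ : H ⊗[k] H →ₗ[k] k) : Prop extends IsInfinitesimalRForm R χ where
  symm : toConv R * toConv χ = toConv (flip χ) * toConv R

end Cartier

/-! ### Braided vector spaces -/

section Braided

variable {k V : Type*} [Field k] [AddCommGroup V] [Module k V]

/-- `c₁₂ = c ⊗ id` on `V ⊗ V ⊗ V`. -/
def op12 (c : Module.End k (V ⊗[k] V)) : Module.End k ((V ⊗[k] V) ⊗[k] V) :=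
  LinearMap.rTensor V c

/-- `c₂₃ = id ⊗ c` on `V ⊗ V ⊗ V`. -/
def op23 (c : Module.End k (V ⊗[k] V)) : Module.End k ((V ⊗[k] V) ⊗[k] V) :=
  (TensorProduct.assoc k V V V).symm.toLinearMap ∘ₗ LinearMap.lTensor V c ∘ₗ
    (TensorProduct.assoc k V V V).toLinearMap

/-- `(V, c)` is a braided vector space: `c` is an invertible solution of the braid equation. -/
structure IsBraided (c : Module.End k (V ⊗[k] V)) : Prop where
  isUnit : IsUnit c
  braid : op12 c * op23 c * op12 c = op23 c * op12 c * op23 c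

variable {ι : Type*} [Fintype ι]

/-- The coefficients `c_{ij}^{pq}` of `c` in the basis `b`:
`c (b i ⊗ b j) = ∑ p q, c_{ij}^{pq} b p ⊗ b q`. -/
def braidCoeff (b : Module.Basis ι k V) (c : Module.End k (V ⊗[k] V)) (i j p q : ι) : k :=
  (b.tensorProduct b).repr (c (b i ⊗ₜ b j)) (p, q)

/-- The braid equation for a tensor of coefficients. -/
def CoeffBraid (γ : ι → ι → ι → ι → k) : Prop :=
  ∀ m n i j p l, ∑ x, ∑ y, ∑ s, γ m n x y * γ y i s l * γ x s j p =
    ∑ s, ∑ y, ∑ x, γ n i s y * γ m s j x * γ x y p l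


lemma apply_eq_sum_braidCoeff (b : Module.Basis ι k V) (c : Module.End k (V ⊗[k] V)) (i j : ι) :
    c (b i ⊗ₜ b j) = ∑ p, ∑ q, braidCoeff b c i j p q • (b p ⊗ₜ[k] b q) := by
  rw [← (b.tensorProduct b).sum_repr (c (b i ⊗ₜ b j)), Fintype.sum_prod_type]
  simp [braidCoeff]

open Classical in
lemma IsBraided.coeffBraid {c : Module.End k (V ⊗[k] V)} (h : IsBraided c)
    (b : Module.Basis ι k V) : CoeffBraid (braidCoeff b c) := by
  have h12 : ∀ i j l, op12 c ((b i ⊗ₜ b j) ⊗ₜ b l) =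
      ∑ p, ∑ q, braidCoeff b c i j p q • ((b p ⊗ₜ[k] b q) ⊗ₜ[k] b l) := by
    intro i j l
    simp [op12, apply_eq_sum_braidCoeff b c, sum_tmul, smul_tmul']
  have h23 : ∀ i j l, op23 c ((b l ⊗ₜ b i) ⊗ₜ b j) =
      ∑ p, ∑ q, braidCoeff b c i j p q • ((b l ⊗ₜ[k] b p) ⊗ₜ[k] b q) := by
    intro i j l
    simp [op23, apply_eq_sum_braidCoeff b c, tmul_sum]
  intro m n i j p l
  have := congrArg (fun f => ((b.tensorProduct b).tensorProduct b).repr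
    (f ((b m ⊗ₜ b n) ⊗ₜ b i)) ((j, p), l)) h.braid
  simp [h12, h23, Finsupp.single_apply] at this
  simpa only [Finset.mul_sum, mul_assoc] using this

end Braided

/-! ### The FRT bialgebra -/

section FRT

variable {k ι : Type*} [Field k] [Fintype ι]

/-- The defining relations of `A(c)` on the free algebra `k{T_i^j}`, where the pair `(i, j)`
stands for the generator `T_i^j`:
`∑ c_{ij}^{mn} T_m^p T_n^q = ∑ T_i^m T_j^n c_{mn}^{pq}`. -/
inductive FRTRel (γ : ι → ι → ι → ι → k) : FreeAlgebra k (ι × ι) → FreeAlgebra k (ι × ι) → Prop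
  | rel (i j p q : ι) : FRTRel γ
      (∑ m, ∑ n, γ i j m n • (FreeAlgebra.ι k (m, p) * FreeAlgebra.ι k (n, q)))
      (∑ m, ∑ n, γ m n p q • (FreeAlgebra.ι k (i, m) * FreeAlgebra.ι k (j, n)))

/-- The algebra `A(c)`, for the coefficients `γ i j p q = c_{ij}^{pq}`: the quotient of the free
algebra by the two-sided ideal generated by the relations `FRTRel`. -/
def FRTAlgebra (γ : ι → ι → ι → ι → k) : Type _ := RingQuot (FRTRel γ)

namespace FRTAlgebra

lemma sum_comm_four {M : Type*} [AddCommMonoid M] (f : ι → ι → ι → ι → M) :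
    ∑ m, ∑ n, ∑ s, ∑ r, f m n s r = ∑ s, ∑ r, ∑ m, ∑ n, f m n s r := by
  have := Finset.sum_comm (s := Finset.univ) (t := Finset.univ)
    (f := fun (x y : ι × ι) => f x.1 x.2 y.1 y.2)
  simpa only [Fintype.sum_prod_type] using this

variable (γ : ι → ι → ι → ι → k)

instance : Ring (FRTAlgebra γ) := inferInstanceAs (Ring (RingQuot (FRTRel γ)))

instance : Algebra k (FRTAlgebra γ) := inferInstanceAs (Algebra k (RingQuot (FRTRel γ)))

/-- The generator `T_i^j` of `A(c)`. -/
def T (i j : ι) : FRTAlgebra γ := RingQuot.mkAlgHom k (FRTRel γ) (FreeAlgebra.ι k (i, j))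

lemma T_rel (i j p q : ι) :
    ∑ m, ∑ n, γ i j m n • (T γ m p * T γ n q) = ∑ m, ∑ n, γ m n p q • (T γ i m * T γ j n) := by
  have := RingQuot.mkAlgHom_rel k (FRTRel.rel (γ := γ) i j p q)
  simp only [map_sum, map_smul, map_mul] at this
  exact this

variable {γ} in
/-- Algebra maps out of `A(c)` are given by matrices satisfying the defining relations. -/
def lift {B : Type*} [Ring B] [Algebra k B] (t : ι → ι → B)
    (ht : ∀ i j p q, ∑ m, ∑ n, γ i j m n • (t m p * t n q) =
      ∑ m, ∑ n, γ m n p q • (t i m * t j n)) : FRTAlgebra γ →ₐ[k] B :=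
  RingQuot.liftAlgHom k ⟨FreeAlgebra.lift k fun x => t x.1 x.2, by
    rintro _ _ ⟨i, j, p, q⟩
    simpa only [map_sum, map_smul, map_mul, FreeAlgebra.lift_ι_apply] using ht i j p q⟩

variable {γ} in
@[simp]
lemma lift_T {B : Type*} [Ring B] [Algebra k B] (t : ι → ι → B)
    (ht : ∀ i j p q, ∑ m, ∑ n, γ i j m n • (t m p * t n q) =
      ∑ m, ∑ n, γ m n p q • (t i m * t j n)) (i j : ι) : lift t ht (T γ i j) = t i j := by
  unfold lift T
  erw [RingQuot.liftAlgHom_mkAlgHom_apply]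
  simp

variable {γ} in
lemma algHom_ext {B : Type*} [Ring B] [Algebra k B] {f g : FRTAlgebra γ →ₐ[k] B}
    (h : ∀ i j, f (T γ i j) = g (T γ i j)) : f = g := by
  apply RingQuot.ringQuot_ext' (S := k) (s := FRTRel γ)
  apply FreeAlgebra.hom_ext
  funext x
  exact h x.1 x.2

variable {γ} in
lemma induction_on {P : FRTAlgebra γ → Prop} (x : FRTAlgebra γ)
    (hr : ∀ r : k, P (algebraMap k _ r)) (hT : ∀ i j, P (T γ i j))
    (hmul : ∀ x y, P x → P y → P (x * y)) (hadd : ∀ x y, P x → P y → P (x + y)) : P x := by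
  obtain ⟨a, rfl⟩ := RingQuot.mkAlgHom_surjective k (FRTRel γ) x
  induction a using FreeAlgebra.induction with
  | grade0 r => rw [AlgHom.commutes]; exact hr r
  | grade1 x => exact hT x.1 x.2
  | mul a b ha hb => rw [map_mul]; exact hmul _ _ ha hb
  | add a b ha hb => rw [map_add]; exact hadd _ _ ha hb

/-- The coproduct, `Δ(T_i^j) = ∑ T_i^s ⊗ T_s^j`. -/
def comulHom : FRTAlgebra γ →ₐ[k] FRTAlgebra γ ⊗[k] FRTAlgebra γ :=
  lift (fun i j => ∑ s, T γ i s ⊗ₜ[k] T γ s j) (by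
    intro i j p q
    have e1 : ∀ m p n q, (∑ s, T γ m s ⊗ₜ[k] T γ s p) * (∑ s, T γ n s ⊗ₜ[k] T γ s q) =
        ∑ s, ∑ r, (T γ m s * T γ n r) ⊗ₜ[k] (T γ s p * T γ r q) := by
      intro m p n q
      simp [Finset.sum_mul_sum]
    simp only [e1, Finset.smul_sum, smul_tmul']
    have l : ∑ s, ∑ r, (∑ m, ∑ n, γ i j m n • (T γ m s * T γ n r)) ⊗ₜ[k] (T γ s p * T γ r q) =
        ∑ s, ∑ r, (T γ i s * T γ j r) ⊗ₜ[k] (∑ m, ∑ n, γ s r m n • (T γ m p * T γ n q)) := by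
      simp only [T_rel γ i j, sum_tmul, tmul_sum, smul_tmul]
      exact sum_comm_four _
    simp only [T_rel γ _ _ p q] at l
    simp only [sum_tmul, tmul_sum, tmul_smul, smul_tmul'] at l
    rw [sum_comm_four, l, sum_comm_four])

variable [DecidableEq ι]

/-- The counit, `ε(T_i^j) = δ_i^j`. -/
def counitHom : FRTAlgebra γ →ₐ[k] k :=
  lift (fun i j => if i = j then 1 else 0) (by intro i j p q; simp)

instance : Bialgebra k (FRTAlgebra γ) :=
  Bialgebra.ofAlgHom (comulHom γ) (counitHom γ)
    (by
      apply algHom_ext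
      intro i j
      simp [comulHom, sum_tmul, tmul_sum]
      exact Finset.sum_comm)
    (by
      apply algHom_ext
      intro i j
      simp [comulHom, counitHom, ite_tmul])
    (by
      apply algHom_ext
      intro i j
      simp [comulHom, counitHom, tmul_ite])

lemma comul_T (i j : ι) :
    Coalgebra.comul (R := k) (T γ i j) = ∑ s, T γ i s ⊗ₜ[k] T γ s j := lift_T _ _ i j

lemma counit_T (i j : ι) :
    Coalgebra.counit (R := k) (T γ i j) = if i = j then 1 else 0 := lift_T _ _ i j

/-- The monomial `T_{i₁}^{j₁} ⋯ T_{i_m}^{j_m}` for the word `(i₁, j₁), …, (i_m, j_m)`. -/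
def monomial (w : List (ι × ι)) : FRTAlgebra γ := (w.map fun x => T γ x.1 x.2).prod

/-- The algebra map `x ↦ ε(x) + ∂(x) ϵ` into the dual numbers, given by
`T_i^j ↦ δ_i^j (1 + ϵ)`. -/
def dualHom : FRTAlgebra γ →ₐ[k] DualNumber k :=
  lift (fun i j => if i = j then 1 + DualNumber.eps else 0) (by intro i j p q; simp)

/-- The derivation `∂ : A(c) → k` with `∂(x) = |x| ε(x)` for homogeneous `x` of degree `|x|`. -/
def degDeriv : FRTAlgebra γ →ₗ[k] k := TrivSqZeroExt.sndHom k k ∘ₗ (dualHom γ).toLinearMap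

/-- The algebra map `x ↦ (R(T_i^p ⊗ x))_{i,p}` to the opposite matrix algebra, determined by
`R(T_i^p ⊗ T_j^q) = c_{ji}^{pq}`. -/
def rMatrix (hγ : CoeffBraid γ) : FRTAlgebra γ →ₐ[k] (Matrix ι ι k)ᵐᵒᵖ :=
  lift (fun j q => MulOpposite.op (Matrix.of fun i p => γ j i p q)) (by
    intro m n p l
    apply MulOpposite.unop_injective
    ext i j
    have h := hγ m n i j p l
    simp only [mul_assoc] at h
    simp [Matrix.sum_apply, Matrix.mul_apply]
    simp only [Finset.mul_sum]
    rw [h]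
    refine (Finset.sum_comm.trans (Finset.sum_congr rfl fun y _ => Finset.sum_comm)).trans
      (Finset.sum_comm.trans ?_)
    refine Finset.sum_congr rfl fun x _ => Finset.sum_congr rfl fun y _ =>
      Finset.sum_congr rfl fun s _ => by ring)

/-- The linear form `x ↦ R(T_i^p ⊗ x)` on `A(c)`. -/
def rRow (hγ : CoeffBraid γ) (i p : ι) : FRTAlgebra γ →ₗ[k] k :=
  Matrix.entryLinearMap k k i p ∘ₗ (MulOpposite.opLinearEquiv k).symm.toLinearMap ∘ₗ
    (rMatrix γ hγ).toLinearMap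

lemma rRow_T (hγ : CoeffBraid γ) (i p j q : ι) : rRow γ hγ i p (T γ j q) = γ j i p q := by
  simp [rRow, rMatrix]

lemma rRow_one (hγ : CoeffBraid γ) (i p : ι) :
    rRow γ hγ i p 1 = if i = p then 1 else 0 := by
  simp [rRow, Matrix.one_apply]

lemma rRow_mul (hγ : CoeffBraid γ) (i p : ι) (x y : FRTAlgebra γ) :
    rRow γ hγ i p (x * y) = ∑ s, rRow γ hγ i s y * rRow γ hγ s p x := by
  simp [rRow, Matrix.mul_apply]

lemma rRow_tensor_mul (hγ : CoeffBraid γ) (i j p q : ι) (z w : FRTAlgebra γ ⊗[k] FRTAlgebra γ) :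
    LinearMap.mul' k k (TensorProduct.map (rRow γ hγ i p) (rRow γ hγ j q) (z * w)) =
      ∑ s, ∑ t, LinearMap.mul' k k (TensorProduct.map (rRow γ hγ i s) (rRow γ hγ j t) w) *
        LinearMap.mul' k k (TensorProduct.map (rRow γ hγ s p) (rRow γ hγ t q) z) := by
  induction z using TensorProduct.induction_on with
  | zero => simp
  | add z z' hz hz' => simp only [add_mul, map_add, hz, hz', mul_add, Finset.sum_add_distrib]
  | tmul a b =>
    induction w using TensorProduct.induction_on with
    | zero => simp
    | add w w' hw hw' => simp only [add_mul, map_add, hw, hw', mul_add, Finset.sum_add_distrib]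
    | tmul a' b' =>
      simp only [Algebra.TensorProduct.tmul_mul_tmul, TensorProduct.map_tmul,
        LinearMap.mul'_apply, rRow_mul, Finset.sum_mul_sum]
      refine Finset.sum_congr rfl fun x _ => Finset.sum_congr rfl fun y _ => by ring

lemma rRow_rel (hγ : CoeffBraid γ) (i j p q : ι) :
    ∑ m, ∑ n, γ i j m n • (toConv (rRow γ hγ m p) * toConv (rRow γ hγ n q)) =
      ∑ m, ∑ n, γ m n p q • (toConv (rRow γ hγ i m) * toConv (rRow γ hγ j n)) := by
  ext x
  simp only [WithConv.ofConv_sum, WithConv.ofConv_smul, LinearMap.sum_apply, LinearMap.smul_apply,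
    LinearMap.convMul_def, LinearMap.comp_apply, smul_eq_mul]
  induction x using induction_on generalizing i j p q with
  | hr r =>
    simp [Algebra.algebraMap_eq_smul_one, Algebra.TensorProduct.one_def, rRow_one, mul_comm]
  | hT u v =>
    have h := hγ u i j p q v
    simp [comul_T, rRow_T, Finset.mul_sum]
    simp only [mul_assoc] at h
    refine h.symm.trans ?_
    refine Finset.sum_congr rfl fun x _ => Finset.sum_comm.trans ?_
    refine Finset.sum_congr rfl fun y _ => Finset.sum_congr rfl fun s _ => by ring
  | hadd x y hx hy => simp only [map_add, mul_add, Finset.sum_add_distrib, hx, hy]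
  | hmul x y hx hy =>
    simp only [Bialgebra.comul_mul, rRow_tensor_mul, Finset.mul_sum]
    generalize hX : Coalgebra.comul (R := k) x = X at hx ⊢
    generalize hY : Coalgebra.comul (R := k) y = Y at hy ⊢
    set D : FRTAlgebra γ ⊗[k] FRTAlgebra γ → ι → ι → ι → ι → k := fun z i j p q =>
      LinearMap.mul' k k (TensorProduct.map (rRow γ hγ i p) (rRow γ hγ j q) z) with hD
    have hx' : ∀ i j p q, ∑ m, ∑ n, γ i j m n * D X m n p q = ∑ m, ∑ n, γ m n p q * D X i j m n :=
      hx
    have hy' : ∀ i j p q, ∑ m, ∑ n, γ i j m n * D Y m n p q = ∑ m, ∑ n, γ m n p q * D Y i j m n :=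
      hy
    change ∑ m, ∑ n, ∑ s, ∑ t, γ i j m n * (D Y m n s t * D X s t p q) =
      ∑ m, ∑ n, ∑ s, ∑ t, γ m n p q * (D Y i j s t * D X s t m n)
    calc _ = ∑ s, ∑ t, (∑ m, ∑ n, γ i j m n * D Y m n s t) * D X s t p q := by
          rw [sum_comm_four]
          simp only [Finset.sum_mul, mul_assoc]
      _ = ∑ m, ∑ n, D Y i j m n * (∑ s, ∑ t, γ m n s t * D X s t p q) := by
          simp only [hy', Finset.sum_mul, Finset.mul_sum]
          rw [sum_comm_four]
          refine Finset.sum_congr rfl fun m _ => Finset.sum_congr rfl fun n _ =>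
            Finset.sum_congr rfl fun s _ => Finset.sum_congr rfl fun t _ => by ring
      _ = _ := by
          simp only [hx', Finset.mul_sum]
          rw [sum_comm_four]
          refine Finset.sum_congr rfl fun m _ => Finset.sum_congr rfl fun n _ =>
            Finset.sum_congr rfl fun s _ => Finset.sum_congr rfl fun t _ => by ring

/-- The algebra map `x ↦ R(x ⊗ -)` into the convolution algebra of linear forms. -/
def rHom (hγ : CoeffBraid γ) : FRTAlgebra γ →ₐ[k] WithConv (FRTAlgebra γ →ₗ[k] k) :=
  lift (fun i p => toConv (rRow γ hγ i p)) (rRow_rel γ hγ)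

/-- The coquasitriangular structure `R` of `A(c)`: the bialgebra bicharacter with
`R(T_i^p ⊗ T_j^q) = c_{ji}^{pq}`. -/
def rForm (hγ : CoeffBraid γ) : FRTAlgebra γ ⊗[k] FRTAlgebra γ →ₗ[k] k :=
  TensorProduct.lift ((WithConv.linearEquiv k (FRTAlgebra γ →ₗ[k] k)).toLinearMap ∘ₗ
    (rHom γ hγ).toLinearMap)

end FRTAlgebra

end FRT

/-! ### The FRT bialgebra of a braided vector space -/

section

variable {k V ι : Type*} [Field k] [AddCommGroup V] [Module k V] [Fintype ι]

/-- The FRT bialgebra `A(c)`, in the basis `b` of `V`. -/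
abbrev FRT (b : Module.Basis ι k V) (c : Module.End k (V ⊗[k] V)) : Type _ :=
  FRTAlgebra (braidCoeff b c)

namespace FRT

variable [DecidableEq ι] (b : Module.Basis ι k V) (c : Module.End k (V ⊗[k] V))

/-- The counit of `A(c)`. -/
abbrev counit : FRT b c →ₗ[k] k := Coalgebra.counit

/-- The generator `T_i^j` of `A(c)`. -/
abbrev T (i j : ι) : FRT b c := FRTAlgebra.T (braidCoeff b c) i j

/-- The monomial `T_{i₁}^{j₁} ⋯ T_{i_m}^{j_m}` of `A(c)`. -/
abbrev monomial (w : List (ι × ι)) : FRT b c := FRTAlgebra.monomial (braidCoeff b c) w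

/-- The derivation `∂` of `A(c)`. -/
abbrev degDeriv : FRT b c →ₗ[k] k := FRTAlgebra.degDeriv (braidCoeff b c)

/-- The coquasitriangular structure `R` of `A(c)`. -/
abbrev rForm {c : Module.End k (V ⊗[k] V)} (hc : IsBraided c) : FRT b c ⊗[k] FRT b c →ₗ[k] k :=
  FRTAlgebra.rForm (braidCoeff b c) (hc.coeffBraid b)

end FRT

end

end

/-!
`R` is a bicharacter, so an identity between convolution products built from `R` and the
multiplication survives products in each variable and need only be checked on the generators
`T_i^j`, where it is one of the defining relations of `A(c)`. The convolution inverse of `R` comes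
from the bicharacter of `c⁻¹`, pulled back along the bialgebra map `A(c) → A(c⁻¹)` fixing the
generators: `A(c)` and `A(c⁻¹)` have the same relations.

`ε + ∂ϵ` is an algebra map to the dual numbers that takes scalar-matrix values on `(T_i^j)`. Hence
`∂` is an `ε`-derivation and it is cocentral, `∂(x₁) x₂ = x₁ ∂(x₂)`. So `χ = λ ∂ ⊗ ∂` and its legs
are central for convolution; the conjugations by `R` cancel, and what is left of the conditions on
`χ` is the Leibniz rule for `∂`.
-/

noncomputable section

namespace Cartier

section Convolution

variable {k C D E B : Type*} [CommRing k] [AddCommGroup C] [Module k C] [Coalgebra k C]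
  [AddCommGroup D] [Module k D] [Coalgebra k D] [AddCommGroup E] [Module k E] [Coalgebra k E]
  [Semiring B] [Algebra k B]

/-- Precomposition with a coalgebra map, as a map of convolution algebras. -/
def convComp (φ : C →ₗc[k] D) : WithConv (D →ₗ[k] B) →ₐ[k] WithConv (C →ₗ[k] B) :=
  AlgHom.ofLinearMap
    ((WithConv.linearEquiv k _).symm.toLinearMap ∘ₗ LinearMap.lcomp k B φ.toLinearMap ∘ₗ
      (WithConv.linearEquiv k _).toLinearMap)
    (by ext x; exact congrArg (algebraMap k B) (CoalgHomClass.counit_comp_apply φ x))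
    fun f g => WithConv.ext (LinearMap.convMul_comp_coalgHom_distrib f g φ)

lemma convComp_apply (φ : C →ₗc[k] D) (f : WithConv (D →ₗ[k] B)) (x : C) :
    convComp φ f x = f (φ x) := rfl

variable (k C D) in
/-- The coalgebra map `id ⊗ ε`. -/
def tensorFst : C ⊗[k] D →ₗc[k] C :=
  (Coalgebra.TensorProduct.rid k k C).toCoalgHom.comp
    (CoalgHom.lTensor C (Coalgebra.counitCoalgHom k D))

variable (k C D) in
/-- The coalgebra map `ε ⊗ id`. -/
def tensorSnd : C ⊗[k] D →ₗc[k] D :=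
  (Coalgebra.TensorProduct.lid k D).toCoalgHom.comp
    (CoalgHom.rTensor D (Coalgebra.counitCoalgHom k C))

lemma tensorFst_tmul (x : C) (y : D) :
    tensorFst k C D (x ⊗ₜ[k] y) = Coalgebra.counit (R := k) y • x := rfl

lemma tensorSnd_tmul (x : C) (y : D) :
    tensorSnd k C D (x ⊗ₜ[k] y) = Coalgebra.counit (R := k) x • y := rfl

lemma convMul_tmul {ι κ : Type*} {x : C} {y : D} (𝓧 : Coalgebra.Repr k x ι)
    (𝓨 : Coalgebra.Repr k y κ) (f g : WithConv (C ⊗[k] D →ₗ[k] B)) :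
    (f * g) (x ⊗ₜ[k] y) = ∑ i ∈ 𝓧.index, ∑ j ∈ 𝓨.index,
      f (𝓧.left i ⊗ₜ 𝓨.left j) * g (𝓧.right i ⊗ₜ 𝓨.right j) := by
  rw [Finset.sum_comm]
  simp [LinearMap.convMul_apply, TensorProduct.comul_tmul, ← 𝓧.eq, ← 𝓨.eq, sum_tmul, tmul_sum]

variable (k C D) in
/-- The flip of two tensor factors, as a coalgebra map. -/
def tensorComm : C ⊗[k] D →ₗc[k] D ⊗[k] C where
  toLinearMap := (TensorProduct.comm k C D).toLinearMap
  counit_comp := by ext; simp [mul_comm]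
  map_comp_comul := by
    ext x y
    suffices h : TensorProduct.map (TensorProduct.comm k C D).toLinearMap
        (TensorProduct.comm k C D).toLinearMap (TensorProduct.tensorTensorTensorComm k C C D D
          (Coalgebra.comul x ⊗ₜ Coalgebra.comul y)) =
        TensorProduct.tensorTensorTensorComm k D D C C
          (Coalgebra.comul y ⊗ₜ Coalgebra.comul x) from h
    hopf_tensor_induction Coalgebra.comul (R := k) x with x₁ x₂
    hopf_tensor_induction Coalgebra.comul (R := k) y with y₁ y₂
    simp

lemma tensorComm_tmul (x : C) (y : D) : tensorComm k C D (x ⊗ₜ[k] y) = y ⊗ₜ x := rfl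

/-- Currying in the first variable, as a map of convolution algebras. -/
def convCurry : WithConv (C ⊗[k] D →ₗ[k] B) →ₐ[k] WithConv (C →ₗ[k] WithConv (D →ₗ[k] B)) :=
  AlgHom.ofLinearMap
    ((WithConv.linearEquiv k _).symm.toLinearMap ∘ₗ
      LinearMap.llcomp k C _ _ (WithConv.linearEquiv k (D →ₗ[k] B)).symm.toLinearMap ∘ₗ
      TensorProduct.lcurry (.id k) C D B ∘ₗ (WithConv.linearEquiv k _).toLinearMap)
    (by
      ext x y
      simp [Algebra.smul_def, Algebra.commutes (Coalgebra.counit x)])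
    fun f g => by
      ext x y
      let 𝓧 := Coalgebra.Repr.arbitrary k x
      let 𝓨 := Coalgebra.Repr.arbitrary k y
      trans (f * g) (x ⊗ₜ y)
      · rfl
      · simp [convMul_tmul 𝓧 𝓨, 𝓧.convMul_apply, 𝓨.convMul_apply]

lemma convMul_tensorFst_tensorSnd (f : WithConv (C →ₗ[k] B)) (g : WithConv (D →ₗ[k] B))
    (x : C) (y : D) :
    (convComp (tensorFst k C D) f * convComp (tensorSnd k C D) g) (x ⊗ₜ[k] y) = f x * g y := by
  let 𝓧 := Coalgebra.Repr.arbitrary k x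
  let 𝓨 := Coalgebra.Repr.arbitrary k y
  have hf : f x = ∑ i ∈ 𝓧.index, f (𝓧.left i) * (1 : WithConv (C →ₗ[k] B)) (𝓧.right i) := by
    rw [← 𝓧.convMul_apply, mul_one]
  have hg : g y = ∑ j ∈ 𝓨.index, (1 : WithConv (D →ₗ[k] B)) (𝓨.left j) * g (𝓨.right j) := by
    rw [← 𝓨.convMul_apply, one_mul]
  rw [convMul_tmul 𝓧 𝓨, hf, hg, Finset.sum_mul_sum]
  refine Finset.sum_congr rfl fun i _ => Finset.sum_congr rfl fun j _ => ?_
  simp [convComp_apply, tensorFst_tmul, tensorSnd_tmul, ← Algebra.smul_def, ← Algebra.commutes,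
    smul_comm (Coalgebra.counit (R := k) (𝓨.left j))]

lemma convMul_tensorSnd_tensorFst (f : WithConv (C →ₗ[k] B)) (g : WithConv (D →ₗ[k] B))
    (x : C) (y : D) :
    (convComp (tensorSnd k C D) g * convComp (tensorFst k C D) f) (x ⊗ₜ[k] y) = g y * f x := by
  have hg : convComp (tensorSnd k C D) g =
      convComp (tensorComm k C D) (convComp (tensorFst k D C) g) := by ext; rfl
  have hf : convComp (tensorFst k C D) f =
      convComp (tensorComm k C D) (convComp (tensorSnd k D C) f) := by ext; rfl
  rw [hf, hg, ← map_mul, convComp_apply, tensorComm_tmul, convMul_tensorFst_tensorSnd]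

/-- Currying in the second variable, as a map of convolution algebras. -/
def convCurryRight : WithConv (C ⊗[k] D →ₗ[k] B) →ₐ[k] WithConv (D →ₗ[k] WithConv (C →ₗ[k] B)) :=
  convCurry.comp (convComp (tensorComm k D C))

lemma convCurry_injective : Function.Injective
    (convCurry : WithConv (C ⊗[k] D →ₗ[k] B) →ₐ[k] WithConv (C →ₗ[k] WithConv (D →ₗ[k] B))) := by
  intro f g h
  ext x y
  exact congr($h x y)

lemma convCurryRight_injective : Function.Injective
    (convCurryRight :
      WithConv (C ⊗[k] D →ₗ[k] B) →ₐ[k] WithConv (D →ₗ[k] WithConv (C →ₗ[k] B))) := by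
  intro f g h
  ext x y
  exact congr($h y x)

lemma convCurry_convComp_rTensor (φ : C →ₗc[k] E) (f : WithConv (E ⊗[k] D →ₗ[k] B)) :
    convCurry (convComp (CoalgHom.rTensor D φ) f) = convComp φ (convCurry f) := rfl

lemma convCurryRight_convComp_lTensor (φ : D →ₗc[k] E) (f : WithConv (C ⊗[k] E →ₗ[k] B)) :
    convCurryRight (convComp (CoalgHom.lTensor C φ) f) = convComp φ (convCurryRight f) := rfl

end Convolution

section Postcomposition

variable {k C A B : Type*} [CommSemiring k] [AddCommMonoid C] [Module k C] [Coalgebra k C]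
  [Semiring A] [Algebra k A] [Semiring B] [Algebra k B]

/-- Postcomposition with an algebra map, as a map of convolution algebras. -/
def convMap (h : A →ₐ[k] B) : WithConv (C →ₗ[k] A) →ₐ[k] WithConv (C →ₗ[k] B) :=
  AlgHom.ofLinearMap
    ((WithConv.linearEquiv k _).symm.toLinearMap ∘ₗ LinearMap.llcomp k C A B h.toLinearMap ∘ₗ
      (WithConv.linearEquiv k _).toLinearMap)
    (by ext x; exact h.commutes _)
    fun f g => WithConv.ext (LinearMap.algHom_comp_convMul_distrib h f g)

variable (k C) in
/-- The element `b` of `B` as the linear map `x ↦ ε(x) b`. -/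
def convConst : B →ₐ[k] WithConv (C →ₗ[k] B) :=
  AlgHom.ofLinearMap
    ((WithConv.linearEquiv k _).symm.toLinearMap ∘ₗ
      LinearMap.smulRightₗ (Coalgebra.counit (R := k) (A := C)))
    (by ext x; simp [Algebra.algebraMap_eq_smul_one])
    fun a b => by
      ext x
      let 𝓧 := Coalgebra.Repr.arbitrary k x
      have hx : Coalgebra.counit x =
          ∑ i ∈ 𝓧.index, Coalgebra.counit (R := k) (𝓧.left i) * Coalgebra.counit (𝓧.right i) := by
        conv_lhs => rw [← Coalgebra.sum_counit_smul 𝓧]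
        simp
      trans Coalgebra.counit (R := k) x • (a * b)
      · rfl
      · rw [𝓧.convMul_apply, hx, Finset.sum_smul]
        exact Finset.sum_congr rfl fun i _ => (smul_mul_smul_comm _ _ _ _).symm

lemma convConst_apply (b : B) (x : C) : convConst k C b x = Coalgebra.counit (R := k) x • b := rfl

lemma convConst_mul_apply (b : B) (f : WithConv (C →ₗ[k] B)) (x : C) :
    (convConst k C b * f) x = b * f x := by
  let 𝓧 := Coalgebra.Repr.arbitrary k x
  conv_rhs => rw [← one_mul f, 𝓧.convMul_apply, Finset.mul_sum]
  simp [𝓧.convMul_apply, convConst_apply, ← Algebra.smul_def]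

lemma mul_convConst_apply (b : B) (f : WithConv (C →ₗ[k] B)) (x : C) :
    (f * convConst k C b) x = f x * b := by
  let 𝓧 := Coalgebra.Repr.arbitrary k x
  conv_rhs => rw [← mul_one f, 𝓧.convMul_apply, Finset.sum_mul]
  simp [𝓧.convMul_apply, convConst_apply, ← Algebra.smul_def, ← Algebra.commutes]

end Postcomposition

section Sandwich

variable {k H B : Type*} [CommSemiring k] [Semiring H] [Bialgebra k H] [Semiring B] [Algebra k B]

/-- The convolution product of two algebra maps with commuting values, as an algebra map. -/
def convMulAlgHom (f g : H →ₐ[k] B) (hfg : ∀ x y, Commute (f x) (g y)) : H →ₐ[k] B :=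
  (Algebra.TensorProduct.lift f g hfg).comp (Bialgebra.comulAlgHom k H)

lemma convMulAlgHom_apply (f g : H →ₐ[k] B) (hfg : ∀ x y, Commute (f x) (g y)) {ι : Type*} {x : H}
    (𝓧 : Coalgebra.Repr k x ι) :
    convMulAlgHom f g hfg x = ∑ i ∈ 𝓧.index, f (𝓧.left i) * g (𝓧.right i) := by
  simp [convMulAlgHom, ← 𝓧.eq]

/-- The operator `t ↦ f(x₁) t g(x₂)` attached to `x₁ ⊗ x₂`: identities between convolution
products of multiplicative and antimultiplicative maps become identities between operators. -/
def sandwich (f g : H →ₗ[k] B) : H ⊗[k] H →ₗ[k] Module.End k B :=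
  TensorProduct.lift ((LinearMap.mul k (Module.End k B)).compl₁₂ (LinearMap.mul k B ∘ₗ f)
    ((LinearMap.mul k B).flip ∘ₗ g))

lemma sandwich_tmul (f g : H →ₗ[k] B) (x y : H) (t : B) :
    sandwich f g (x ⊗ₜ y) t = f x * (t * g y) := rfl

lemma convMul_apply_eq_sandwich (f g : H →ₗ[k] B) (x : H) :
    (toConv f * toConv g) x = sandwich f g (Coalgebra.comul x) 1 := by
  simp [(Coalgebra.Repr.arbitrary k x).convMul_apply, ← (Coalgebra.Repr.arbitrary k x).eq,
    sandwich_tmul]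

variable {f g : H →ₗ[k] B}

lemma sandwich_mul (hf : ∀ x y, f (x * y) = f x * f y) (hg : ∀ x y, g (x * y) = g y * g x)
    (z w : H ⊗[k] H) : sandwich f g (z * w) = sandwich f g z * sandwich f g w := by
  induction z using TensorProduct.induction_on with
  | zero => simp
  | add z z' hz hz' => simp only [add_mul, map_add, hz, hz']
  | tmul x y =>
    induction w using TensorProduct.induction_on with
    | zero => simp
    | add w w' hw hw' => simp only [mul_add, map_add, hw, hw']
    | tmul x' y' =>
      ext t
      simp [sandwich_tmul, hf, hg, mul_assoc]

lemma sandwich_mul_rev (hf : ∀ x y, f (x * y) = f y * f x) (hg : ∀ x y, g (x * y) = g x * g y)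
    (z w : H ⊗[k] H) : sandwich f g (z * w) = sandwich f g w * sandwich f g z := by
  induction z using TensorProduct.induction_on with
  | zero => simp
  | add z z' hz hz' => simp only [add_mul, mul_add, map_add, hz, hz']
  | tmul x y =>
    induction w using TensorProduct.induction_on with
    | zero => simp
    | add w w' hw hw' => simp only [add_mul, mul_add, map_add, hw, hw']
    | tmul x' y' =>
      ext t
      simp [sandwich_tmul, hf, hg, mul_assoc]

lemma commute_sandwich (hfg : ∀ x y, Commute (f x) (g y)) (z w : H ⊗[k] H) :
    Commute (sandwich f g z) (sandwich g f w) := by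
  induction z using TensorProduct.induction_on with
  | zero => simp
  | add z z' hz hz' => simpa only [map_add] using hz.add_left hz'
  | tmul x y =>
    induction w using TensorProduct.induction_on with
    | zero => simp
    | add w w' hw hw' => simpa only [map_add] using hw.add_right hw'
    | tmul x' y' =>
      ext t
      calc f x * (g x' * (t * f y') * g y) = f x * g x' * t * (f y' * g y) := by
            simp only [mul_assoc]
        _ = g x' * f x * t * (g y * f y') := by rw [(hfg x x').eq, (hfg y' y).eq]
        _ = g x' * (f x * (t * g y) * f y') := by simp only [mul_assoc]

lemma convMul_mul_eq_of_map_mul_of_map_mul_rev (hf : ∀ x y, f (x * y) = f x * f y)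
    (hg : ∀ x y, g (x * y) = g y * g x) {x y : H}
    (hx : (toConv f * toConv g) x = (1 : WithConv (H →ₗ[k] B)) x)
    (hy : (toConv f * toConv g) y = (1 : WithConv (H →ₗ[k] B)) y) :
    (toConv f * toConv g) (x * y) = (1 : WithConv (H →ₗ[k] B)) (x * y) := by
  simp only [convMul_apply_eq_sandwich, Bialgebra.comul_mul, sandwich_mul hf hg,
    Module.End.mul_apply, LinearMap.convOne_apply] at hx hy ⊢
  rw [hy, Algebra.algebraMap_eq_smul_one, map_smul, hx]
  simp [Algebra.smul_def, ← map_mul, mul_comm]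

lemma convMul_mul_eq_of_map_mul_rev_of_map_mul (hf : ∀ x y, f (x * y) = f y * f x)
    (hg : ∀ x y, g (x * y) = g x * g y) {x y : H}
    (hx : (toConv f * toConv g) x = (1 : WithConv (H →ₗ[k] B)) x)
    (hy : (toConv f * toConv g) y = (1 : WithConv (H →ₗ[k] B)) y) :
    (toConv f * toConv g) (x * y) = (1 : WithConv (H →ₗ[k] B)) (x * y) := by
  simp only [convMul_apply_eq_sandwich, Bialgebra.comul_mul, sandwich_mul_rev hf hg,
    Module.End.mul_apply, LinearMap.convOne_apply] at hx hy ⊢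
  rw [hx, Algebra.algebraMap_eq_smul_one, map_smul, hy]
  simp [Algebra.smul_def]

lemma convMul_algebraMap_eq_one (hf : f 1 = 1) (hg : g 1 = 1) (r : k) :
    (toConv f * toConv g) (algebraMap k H r) = (1 : WithConv (H →ₗ[k] B)) (algebraMap k H r) := by
  simp [Algebra.algebraMap_eq_smul_one, Algebra.TensorProduct.one_def, hf, hg]

lemma sandwich_comul_mul_exchange (hf : ∀ x y, f (x * y) = f y * f x)
    (hg : ∀ x y, g (x * y) = g x * g y) (hfg : ∀ x y, Commute (f x) (g y)) {t : B} {x y : H}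
    (hx : sandwich f g (Coalgebra.comul x) t = sandwich g f (Coalgebra.comul x) t)
    (hy : sandwich f g (Coalgebra.comul y) t = sandwich g f (Coalgebra.comul y) t) :
    sandwich f g (Coalgebra.comul (x * y)) t = sandwich g f (Coalgebra.comul (x * y)) t := by
  have hcomm := (commute_sandwich hfg (Coalgebra.comul y) (Coalgebra.comul x)).eq
  calc sandwich f g (Coalgebra.comul (x * y)) t
      = (sandwich f g (Coalgebra.comul y) * sandwich g f (Coalgebra.comul x)) t := by
        rw [Bialgebra.comul_mul, sandwich_mul_rev hf hg, Module.End.mul_apply, hx,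
          Module.End.mul_apply]
    _ = sandwich g f (Coalgebra.comul (x * y)) t := by
        rw [hcomm, Bialgebra.comul_mul, sandwich_mul hg hf, Module.End.mul_apply, hy,
          Module.End.mul_apply]

end Sandwich

section Bicharacter

variable {k H : Type*} [Field k] [Ring H] [Bialgebra k H]

/-- A bicharacter on a bialgebra: both curried forms `x ↦ f(x ⊗ -)` and `y ↦ f(- ⊗ y)` into the
convolution algebra of linear forms are unital, the first is multiplicative and the second is
antimultiplicative. -/
structure IsBicharacter (f : H ⊗[k] H →ₗ[k] k) : Prop where
  convCurry_one : convCurry (toConv f) 1 = 1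
  convCurry_mul (x y : H) :
    convCurry (toConv f) (x * y) = convCurry (toConv f) x * convCurry (toConv f) y
  convCurryRight_one : convCurryRight (toConv f) 1 = 1
  convCurryRight_mul (x y : H) :
    convCurryRight (toConv f) (x * y) = convCurryRight (toConv f) y * convCurryRight (toConv f) x

lemma toConv_flip (f : H ⊗[k] H →ₗ[k] k) :
    toConv (flip f) = convComp (tensorComm k H H) (toConv f) := rfl

lemma convComp_tensorComm_toConv_flip (f : H ⊗[k] H →ₗ[k] k) :
    convComp (tensorComm k H H) (toConv (flip f)) = toConv f := by
  ext
  rfl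

lemma toConv_leg12 (f : H ⊗[k] H →ₗ[k] k) :
    toConv (leg12 f) = convComp (tensorFst k (H ⊗[k] H) H) (toConv f) := by
  ext x y z
  simp [leg12, convComp_apply, tensorFst_tmul, mul_comm]

lemma toConv_leg23 (f : H ⊗[k] H →ₗ[k] k) :
    toConv (leg23 f) = convComp (CoalgHom.rTensor H (tensorSnd k H H)) (toConv f) := by
  ext x y z
  simp [leg23, convComp_apply, tensorSnd_tmul, ← smul_tmul']

lemma toConv_leg13 (f : H ⊗[k] H →ₗ[k] k) :
    toConv (leg13 f) = convComp (CoalgHom.rTensor H (tensorFst k H H)) (toConv f) := by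
  ext x y z
  simp [leg13, leg23, convComp_apply, tensorFst_tmul, ← smul_tmul']

lemma toConv_comp_mulId (f : H ⊗[k] H →ₗ[k] k) :
    toConv (f ∘ₗ mulId) = convComp (CoalgHom.rTensor H (Bialgebra.mulCoalgHom k H)) (toConv f) :=
  rfl

lemma leg12_convInv_mul_leg12 {f : H ⊗[k] H →ₗ[k] k} (hf : IsUnit (toConv f)) :
    toConv (leg12 (convInv f)) * toConv (leg12 f) = 1 := by
  rw [toConv_leg12, toConv_leg12, ← map_mul, convInv, toConv_ofConv,
    Ring.inverse_mul_cancel _ hf, map_one]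

lemma leg23_convInv_mul_leg23 {f : H ⊗[k] H →ₗ[k] k} (hf : IsUnit (toConv f)) :
    toConv (leg23 (convInv f)) * toConv (leg23 f) = 1 := by
  rw [toConv_leg23, toConv_leg23, ← map_mul, convInv, toConv_ofConv,
    Ring.inverse_mul_cancel _ hf, map_one]

namespace IsBicharacter

variable {f : H ⊗[k] H →ₗ[k] k} (hf : IsBicharacter f)
include hf

lemma toConv_comp_mulId_eq :
    toConv (f ∘ₗ mulId) = toConv (leg13 f) * toConv (leg23 f) := by
  rw [toConv_comp_mulId, toConv_leg13, toConv_leg23]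
  apply convCurry_injective
  simp only [map_mul, convCurry_convComp_rTensor]
  ext x y : 4
  exact (hf.convCurry_mul x y).trans (convMul_tensorFst_tensorSnd _ _ x y).symm

lemma toConv_comp_idMul_eq :
    toConv (f ∘ₗ idMul) = toConv (leg13 f) * toConv (leg12 f) := by
  have h : convComp (CoalgHom.lTensor H (Bialgebra.mulCoalgHom k H)) (toConv f) =
      convComp (CoalgHom.lTensor H (tensorSnd k H H)) (toConv f) *
        convComp (CoalgHom.lTensor H (tensorFst k H H)) (toConv f) := by
    apply convCurryRight_injective
    simp only [map_mul, convCurryRight_convComp_lTensor]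
    ext x y : 4
    exact (hf.convCurryRight_mul x y).trans (convMul_tensorSnd_tensorFst _ _ x y).symm
  have h13 : toConv (leg13 f) = convComp (Coalgebra.TensorProduct.assoc k k H H H).toCoalgHom
      (convComp (CoalgHom.lTensor H (tensorSnd k H H)) (toConv f)) := by
    ext x y z
    simp [leg13, leg23, convComp_apply, tensorSnd_tmul]
  have h12 : toConv (leg12 f) = convComp (Coalgebra.TensorProduct.assoc k k H H H).toCoalgHom
      (convComp (CoalgHom.lTensor H (tensorFst k H H)) (toConv f)) := by
    ext x y z
    simp [leg12, convComp_apply, tensorFst_tmul, mul_comm]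
  rw [h13, h12, ← map_mul, ← h]
  rfl

end IsBicharacter

end Bicharacter

section Functoriality

variable {k H H' : Type*} [Field k] [Ring H] [Bialgebra k H] [Ring H'] [Bialgebra k H']

lemma IsBicharacter.comp_map {f : H' ⊗[k] H' →ₗ[k] k} (hf : IsBicharacter f) (φ : H →ₐc[k] H') :
    IsBicharacter (f ∘ₗ TensorProduct.map (φ : H →ₗ[k] H') (φ : H →ₗ[k] H')) := by
  let comp := convComp (B := k) (φ : H →ₗc[k] H')
  have hl (x : H) : convCurry (toConv (f ∘ₗ TensorProduct.map (φ : H →ₗ[k] H') φ)) x =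
      comp (convCurry (toConv f) (φ x)) := rfl
  have hr (x : H) : convCurryRight (toConv (f ∘ₗ TensorProduct.map (φ : H →ₗ[k] H') φ)) x =
      comp (convCurryRight (toConv f) (φ x)) := rfl
  refine ⟨?_, fun x y => ?_, ?_, fun x y => ?_⟩
  · rw [hl, map_one, hf.convCurry_one, map_one]
  · rw [hl, map_mul, hf.convCurry_mul, map_mul, hl, hl]
  · rw [hr, map_one, hf.convCurryRight_one, map_one]
  · rw [hr, map_mul, hf.convCurryRight_mul, map_mul, hr, hr]

end Functoriality

section Comatrix

variable {k ι C : Type*} [CommRing k] [AddCommGroup C] [Module k C]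

/-- The matrix-valued map `y ↦ (f(t_ij ⊗ y))` attached to a linear form `f` on `C ⊗ C`. -/
def formMatrix (t : ι → ι → C) (f : C ⊗[k] C →ₗ[k] k) : C →ₗ[k] Matrix ι ι k where
  toFun y := Matrix.of fun i j => f (t i j ⊗ₜ y)
  map_add' x y := by ext; simp [tmul_add]
  map_smul' r x := by ext; simp

lemma formMatrix_apply (t : ι → ι → C) (f : C ⊗[k] C →ₗ[k] k) (y : C) (i j : ι) :
    formMatrix t f y i j = f (t i j ⊗ₜ y) := rfl

variable [Coalgebra k C] [Fintype ι] [DecidableEq ι]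

/-- A matrix of elements of a coalgebra is a comatrix if its entries are comultiplied and
counited like the coefficients of a comodule. -/
structure IsComatrix (t : ι → ι → C) : Prop where
  comul_apply (i j : ι) : Coalgebra.comul (R := k) (t i j) = ∑ s, t i s ⊗ₜ[k] t s j
  counit_apply (i j : ι) : Coalgebra.counit (R := k) (t i j) = if i = j then 1 else 0

namespace IsComatrix

variable {t : ι → ι → C} (ht : IsComatrix (k := k) t)
include ht

/-- The comultiplication of an entry of a comatrix, as a sum of pure tensors. -/
def repr (i j : ι) : Coalgebra.Repr k (t i j) ι where
  index := Finset.univ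
  left := t i
  right s := t s j
  eq := (ht.comul_apply i j).symm

lemma convMul_apply {B : Type*} [Semiring B] [Algebra k B] (f g : WithConv (C →ₗ[k] B))
    (i j : ι) : (f * g) (t i j) = ∑ s, f (t i s) * g (t s j) :=
  (ht.repr i j).convMul_apply f g

lemma toConv_formMatrix_convMul (f g : WithConv (C ⊗[k] C →ₗ[k] k)) :
    toConv (formMatrix t (f * g).ofConv) =
      toConv (formMatrix t f.ofConv) * toConv (formMatrix t g.ofConv) := by
  ext y i j
  let 𝓨 := Coalgebra.Repr.arbitrary k y
  rw [𝓨.convMul_apply, Matrix.sum_apply]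
  exact (convMul_tmul (ht.repr i j) 𝓨 f g).trans Finset.sum_comm

lemma toConv_formMatrix_one :
    toConv (formMatrix t (1 : WithConv (C ⊗[k] C →ₗ[k] k)).ofConv) = 1 := by
  ext y i j
  simp [formMatrix_apply, ht.counit_apply, Matrix.algebraMap_matrix_apply]

end IsComatrix

end Comatrix

section BicharacterMatrix

variable {k ι H : Type*} [Field k] [Ring H] [Bialgebra k H] [Fintype ι] [DecidableEq ι]

namespace IsComatrix

variable {t : ι → ι → H} (ht : IsComatrix (k := k) t) {f : H ⊗[k] H →ₗ[k] k}
  (hf : IsBicharacter f)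
include ht hf

lemma formMatrix_one : formMatrix t f 1 = 1 := by
  ext i j
  exact congr($hf.convCurryRight_one (t i j)).trans (by simp [ht.counit_apply, Matrix.one_apply])

lemma formMatrix_mul (x y : H) :
    formMatrix t f (x * y) = formMatrix t f y * formMatrix t f x := by
  ext i j
  exact congr($(hf.convCurryRight_mul x y) (t i j)).trans (ht.convMul_apply _ _ i j)

lemma formMatrix_flip_one : formMatrix t (flip f) 1 = 1 := by
  ext i j
  exact congr($hf.convCurry_one (t i j)).trans (by simp [ht.counit_apply, Matrix.one_apply])

lemma formMatrix_flip_mul (x y : H) :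
    formMatrix t (flip f) (x * y) = formMatrix t (flip f) x * formMatrix t (flip f) y := by
  ext i j
  exact congr($(hf.convCurry_mul x y) (t i j)).trans (ht.convMul_apply _ _ i j)

end IsComatrix

end BicharacterMatrix

section Exchange

variable {k H : Type*} [Field k] [Ring H] [Bialgebra k H]

/-- The matrix `(f(t_ij ⊗ y))` of scalars, with its entries regarded as elements of `H`. -/
def algebraFormMatrix {ι : Type*} [Fintype ι] [DecidableEq ι] (t : ι → ι → H)
    (f : H ⊗[k] H →ₗ[k] k) : H →ₗ[k] Matrix ι ι H :=
  (Algebra.ofId k H).mapMatrix.toLinearMap ∘ₗ formMatrix t f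

namespace IsBicharacter

variable {f : H ⊗[k] H →ₗ[k] k} (hf : IsBicharacter f)
include hf

/-- The algebra map `x ↦ f(x ⊗ -)` into the convolution algebra of `H`-valued maps. -/
def curryHom : H →ₐ[k] WithConv (H →ₗ[k] H) :=
  (convMap (Algebra.ofId k H)).comp
    (AlgHom.ofLinearMap (convCurry (toConv f)).ofConv hf.convCurry_one hf.convCurry_mul)

lemma curryHom_apply (x y : H) : hf.curryHom x y = algebraMap k H (f (x ⊗ₜ y)) := rfl

lemma commute_curryHom_convConst (x a : H) : Commute (hf.curryHom x) (convConst k H a) := by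
  ext y
  rw [mul_convConst_apply, convConst_mul_apply, curryHom_apply, Algebra.commutes]

/-- The algebra map sending `x` to the map `y ↦ f(x₁ ⊗ y) x₂`. -/
def formMulHom : H →ₐ[k] WithConv (H →ₗ[k] H) :=
  convMulAlgHom hf.curryHom (convConst k H) hf.commute_curryHom_convConst

/-- The algebra map sending `x` to the map `y ↦ x₁ f(x₂ ⊗ y)`. -/
def mulFormHom : H →ₐ[k] WithConv (H →ₗ[k] H) :=
  convMulAlgHom (convConst k H) hf.curryHom fun a x => (hf.commute_curryHom_convConst x a).symm

lemma convCurry_unitComp_mul_mul' (x : H) :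
    convCurry (toConv (unitComp f) * toConv (LinearMap.mul' k H)) x =
      hf.formMulHom x * toConv .id := by
  have hmul (a : H) : convCurry (toConv (LinearMap.mul' k H)) a =
      convConst k H a * toConv .id := by
    ext y
    rw [convConst_mul_apply]
    rfl
  let 𝓧 := Coalgebra.Repr.arbitrary k x
  simp only [map_mul, 𝓧.convMul_apply, hmul, formMulHom, convMulAlgHom_apply _ _ _ 𝓧,
    Finset.sum_mul, mul_assoc]
  rfl

lemma convCurry_flip_mul'_mul_unitComp (x : H) :
    convCurry (toConv (flip (LinearMap.mul' k H)) * toConv (unitComp f)) x =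
      toConv .id * hf.mulFormHom x := by
  have hmul (a : H) : convCurry (toConv (flip (LinearMap.mul' k H))) a =
      toConv .id * convConst k H a := by
    ext y
    rw [mul_convConst_apply]
    rfl
  let 𝓧 := Coalgebra.Repr.arbitrary k x
  simp only [map_mul, 𝓧.convMul_apply, hmul, mulFormHom, convMulAlgHom_apply _ _ _ 𝓧,
    Finset.mul_sum, mul_assoc]
  rfl

lemma unitComp_mul_mul'_eq (h : ∀ x, SemiconjBy (toConv .id) (hf.mulFormHom x) (hf.formMulHom x)) :
    toConv (unitComp f) * toConv (LinearMap.mul' k H) =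
      toConv (flip (LinearMap.mul' k H)) * toConv (unitComp f) := by
  apply convCurry_injective
  ext x : 2
  exact (hf.convCurry_unitComp_mul_mul' x).trans
    ((h x).eq.symm.trans (hf.convCurry_flip_mul'_mul_unitComp x).symm)

variable {ι : Type*} [Fintype ι] [DecidableEq ι] {t : ι → ι → H}

lemma semiconjBy_id_of_isComatrix (ht : IsComatrix (k := k) t)
    (h : ∀ y, sandwich (algebraFormMatrix t f) (Matrix.scalarAlgHom ι k).toLinearMap
        (Coalgebra.comul y) (.of t) =
      sandwich (Matrix.scalarAlgHom ι k).toLinearMap (algebraFormMatrix t f)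
        (Coalgebra.comul y) (.of t))
    (i j : ι) : SemiconjBy (toConv .id) (hf.mulFormHom (t i j)) (hf.formMulHom (t i j)) := by
  have hl (y : H) : hf.formMulHom (t i j) y =
      ∑ s, algebraMap k H (f (t i s ⊗ₜ y)) * t s j := by
    simp only [formMulHom, convMulAlgHom_apply _ _ _ (ht.repr i j), WithConv.ofConv_sum,
      LinearMap.sum_apply, mul_convConst_apply]
    rfl
  have hr (y : H) : hf.mulFormHom (t i j) y =
      ∑ s, t i s * algebraMap k H (f (t s j ⊗ₜ y)) := by
    simp only [mulFormHom, convMulAlgHom_apply _ _ _ (ht.repr i j), WithConv.ofConv_sum,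
      LinearMap.sum_apply, convConst_mul_apply]
    rfl
  ext y
  let 𝓨 := Coalgebra.Repr.arbitrary k y
  have hy := congr($(h y) i j)
  simp only [← 𝓨.eq, map_sum, LinearMap.sum_apply, sandwich_tmul, Matrix.sum_apply] at hy
  rw [𝓨.convMul_apply, 𝓨.convMul_apply]
  simp only [hl, hr]
  convert hy.symm using 2
  · simp [Matrix.mul_apply, algebraFormMatrix, formMatrix_apply, Algebra.ofId_apply,
      Matrix.scalar_apply, Matrix.diagonal_apply]
  · simp [Matrix.mul_apply, algebraFormMatrix, formMatrix_apply, Algebra.ofId_apply,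
      Matrix.scalar_apply, Matrix.diagonal_apply, Finset.sum_mul, mul_assoc]

end IsBicharacter

end Exchange

section Cocentral

open Coalgebra

variable {k C D : Type*} [CommRing k] [AddCommGroup C] [Module k C] [Coalgebra k C]
  [AddCommGroup D] [Module k D] [Coalgebra k D]

/-- A linear form `φ` on a coalgebra is cocentral if `φ(x₁) x₂ = x₁ φ(x₂)`, i.e. if it is central
in every convolution algebra. -/
def IsCocentral (φ : C →ₗ[k] k) : Prop :=
  ∀ x, TensorProduct.lid k C (LinearMap.rTensor C φ (comul x)) =
    TensorProduct.rid k C (LinearMap.lTensor C φ (comul x))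

namespace IsCocentral

variable {φ : C →ₗ[k] k}

lemma sum_smul_eq (hφ : IsCocentral φ) {ι : Type*} {x : C} (𝓧 : Coalgebra.Repr k x ι) :
    ∑ i ∈ 𝓧.index, φ (𝓧.left i) • 𝓧.right i = ∑ i ∈ 𝓧.index, φ (𝓧.right i) • 𝓧.left i := by
  simpa [← 𝓧.eq] using hφ x

lemma counit : IsCocentral (Coalgebra.counit (R := k) (A := C)) := by
  intro x
  simp

lemma smul (hφ : IsCocentral φ) (r : k) : IsCocentral (r • φ) := by
  intro x
  simp [LinearMap.rTensor_smul, LinearMap.lTensor_smul, hφ x]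

lemma tmul (hφ : IsCocentral φ) {ψ : D →ₗ[k] k} (hψ : IsCocentral ψ) :
    IsCocentral (LinearMap.mul' k k ∘ₗ TensorProduct.map φ ψ) := by
  intro z
  induction z using TensorProduct.induction_on with
  | zero => simp
  | add z w hz hw => simp only [map_add, hz, hw]
  | tmul x y =>
    let 𝓧 := Coalgebra.Repr.arbitrary k x
    let 𝓨 := Coalgebra.Repr.arbitrary k y
    have h := congr($(hφ.sum_smul_eq 𝓧) ⊗ₜ[k] $(hψ.sum_smul_eq 𝓨))
    rw [TensorProduct.comul_tmul, ← 𝓧.eq, ← 𝓨.eq]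
    simpa [sum_tmul, tmul_sum, smul_tmul, Finset.smul_sum, smul_smul, mul_comm] using h

lemma convMul_comm {B : Type*} [Semiring B] [Algebra k B] (hφ : IsCocentral φ) (f : C →ₗ[k] B) :
    toConv (Algebra.linearMap k B ∘ₗ φ) * toConv f =
      toConv f * toConv (Algebra.linearMap k B ∘ₗ φ) := by
  ext x
  let 𝓧 := Coalgebra.Repr.arbitrary k x
  rw [𝓧.convMul_apply, 𝓧.convMul_apply]
  simpa [Algebra.smul_def, Algebra.commutes] using congr(f $(hφ.sum_smul_eq 𝓧))

lemma commute (hφ : IsCocentral φ) (f : WithConv (C →ₗ[k] k)) : Commute (toConv φ) f :=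
  hφ.convMul_comm f.ofConv

lemma conj_eq (hφ : IsCocentral φ) {f g : WithConv (C →ₗ[k] k)} (hgf : g * f = 1) :
    g * toConv φ * f = toConv φ := by
  rw [mul_assoc, (hφ.commute f).eq, ← mul_assoc, hgf, one_mul]

end IsCocentral

end Cocentral

section Derivation

open Coalgebra

variable {k H : Type*} [Field k] [Ring H] [Bialgebra k H] {d : H →ₗ[k] k}

lemma flip_smul_map_self (r : k) :
    flip (r • (LinearMap.mul' k k ∘ₗ TensorProduct.map d d)) =
      r • (LinearMap.mul' k k ∘ₗ TensorProduct.map d d) := by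
  ext x y
  simp [flip, mul_comm]

lemma IsCocentral.leg13_smul_map (hd : IsCocentral d) (r : k) :
    IsCocentral (leg13 (r • (LinearMap.mul' k k ∘ₗ TensorProduct.map d d))) := by
  have h : leg13 (r • (LinearMap.mul' k k ∘ₗ TensorProduct.map d d)) = r • (LinearMap.mul' k k ∘ₗ
      TensorProduct.map (LinearMap.mul' k k ∘ₗ TensorProduct.map d Coalgebra.counit) d) := by
    ext x y z
    simp [leg13, leg23, mul_left_comm, mul_comm]
  rw [h]
  exact ((hd.tmul .counit).tmul hd).smul r

theorem IsUniversalRForm.isCartier_smul_map {R : H ⊗[k] H →ₗ[k] k} (hR : IsUniversalRForm R)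
    (hd : ∀ x y, d (x * y) = d x * counit (R := k) y + counit (R := k) x * d y)
    (hcocentral : IsCocentral d) (r : k) :
    IsCartier R (r • (LinearMap.mul' k k ∘ₗ TensorProduct.map d d)) := by
  have hχ := (hcocentral.tmul hcocentral).smul r
  have hχ₁₃ := hcocentral.leg13_smul_map r
  refine ⟨⟨hR, hχ.convMul_comm _, ?_, ?_⟩, ?_⟩
  · rw [hχ₁₃.conj_eq (leg12_convInv_mul_leg12 hR.isUnit), ← WithConv.toConv_add]
    congr 1
    ext x y z
    simp only [idMul, AlgebraTensorModule.curry_apply, LinearMap.restrictScalars_self, curry_apply,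
      LinearMap.coe_comp, LinearMap.coe_smul, LinearEquiv.coe_coe, Function.comp_apply, assoc_tmul,
      LinearMap.lTensor_tmul, LinearMap.mul'_apply, Pi.smul_apply, map_tmul, hd, smul_eq_mul, leg12,
      leg13, leg23, LinearMap.add_apply, LinearMap.smul_apply, LinearMap.rTensor_tmul, comm_tmul]
    ring
  · rw [hχ₁₃.conj_eq (leg23_convInv_mul_leg23 hR.isUnit), ← WithConv.toConv_add]
    congr 1
    ext x y z
    simp only [mulId, AlgebraTensorModule.curry_apply, LinearMap.restrictScalars_self, curry_apply,
      LinearMap.coe_comp, LinearMap.coe_smul, Function.comp_apply, LinearMap.rTensor_tmul,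
      LinearMap.mul'_apply, Pi.smul_apply, map_tmul, hd, smul_eq_mul, leg23, leg13,
      LinearMap.add_apply, LinearEquiv.coe_coe, assoc_tmul, LinearMap.smul_apply, comm_tmul]
    ring
  · rw [flip_smul_map_self]
    exact (hχ.commute _).eq.symm

end Derivation

end Cartier

section Coefficients

variable {k V ι : Type*} [Field k] [AddCommGroup V] [Module k V]

/-- The coefficients `c_{ij}^{pq}` as a square matrix with rows `(i, j)` and columns `(p, q)`. -/
def coeffMatrix (γ : ι → ι → ι → ι → k) : Matrix (ι × ι) (ι × ι) k :=
  .of fun x y => γ x.1 x.2 y.1 y.2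

lemma sum_mul_eq_of_coeffMatrix_mul_eq_one [Fintype ι] [DecidableEq ι] {γ δ : ι → ι → ι → ι → k}
    (h : coeffMatrix γ * coeffMatrix δ = 1) (i j p q : ι) :
    ∑ m, ∑ n, γ i j m n * δ m n p q = if i = p ∧ j = q then 1 else 0 := by
  simpa [coeffMatrix, Matrix.mul_apply, Fintype.sum_prod_type, Matrix.one_apply]
    using congr($h (i, j) (p, q))

lemma coeffMatrix_braidCoeff [Fintype ι] [DecidableEq ι] (b : Module.Basis ι k V)
    (c : Module.End k (V ⊗[k] V)) : coeffMatrix (braidCoeff b c) =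
      (LinearMap.toMatrix (b.tensorProduct b) (b.tensorProduct b) c).transpose := by
  ext ⟨i, j⟩ ⟨p, q⟩
  simp [coeffMatrix, braidCoeff, LinearMap.toMatrix_apply]

lemma coeffMatrix_braidCoeff_mul_eq_one [Fintype ι] [DecidableEq ι] (b : Module.Basis ι k V)
    {c d : Module.End k (V ⊗[k] V)} (h : d * c = 1) :
    coeffMatrix (braidCoeff b c) * coeffMatrix (braidCoeff b d) = 1 := by
  rw [coeffMatrix_braidCoeff, coeffMatrix_braidCoeff, ← Matrix.transpose_mul,
    ← LinearMap.toMatrix_mul, h, LinearMap.toMatrix_one, Matrix.transpose_one]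

end Coefficients

section Braided

variable {k V : Type*} [Field k] [AddCommGroup V] [Module k V]

/-- `c ↦ c₁₂` as a map of monoids. -/
def op12Hom : Module.End k (V ⊗[k] V) →* Module.End k ((V ⊗[k] V) ⊗[k] V) where
  toFun := op12
  map_one' := LinearMap.rTensor_id _ _
  map_mul' := LinearMap.rTensor_mul V

/-- `c ↦ c₂₃` as a map of monoids. -/
def op23Hom : Module.End k (V ⊗[k] V) →* Module.End k ((V ⊗[k] V) ⊗[k] V) where
  toFun := op23
  map_one' := by ext; simp [op23]
  map_mul' c d := by ext; simp [op23]

lemma IsBraided.inv {u : (Module.End k (V ⊗[k] V))ˣ} (h : IsBraided (u : Module.End k (V ⊗[k] V))) :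
    IsBraided (↑u⁻¹ : Module.End k (V ⊗[k] V)) where
  isUnit := u⁻¹.isUnit
  braid := by
    have hu : Units.map op12Hom u * Units.map op23Hom u * Units.map op12Hom u =
        Units.map op23Hom u * Units.map op12Hom u * Units.map op23Hom u := Units.ext h.braid
    have hinv := congr((↑($hu)⁻¹ : Module.End k ((V ⊗[k] V) ⊗[k] V)))
    rwa [mul_inv_rev, mul_inv_rev, mul_inv_rev, mul_inv_rev, ← mul_assoc, ← mul_assoc,
      ← map_inv, ← map_inv] at hinv

end Braided

namespace FRTAlgebra

open Coalgebra Cartier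

variable {k ι : Type*} [Field k] [Fintype ι] [DecidableEq ι] {γ : ι → ι → ι → ι → k}

section RForm

variable (γ) in
lemma isComatrix_T : IsComatrix (k := k) (T γ) :=
  ⟨comul_T γ, counit_T γ⟩

lemma rForm_T_tmul (hγ : CoeffBraid γ) (i p : ι) (x : FRTAlgebra γ) :
    rForm γ hγ (T γ i p ⊗ₜ x) = rRow γ hγ i p x :=
  congr($(lift_T _ (rRow_rel γ hγ) i p) x)

lemma rForm_T_tmul_T (hγ : CoeffBraid γ) (i p j q : ι) :
    rForm γ hγ (T γ i p ⊗ₜ T γ j q) = γ j i p q := by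
  rw [rForm_T_tmul, rRow_T]

lemma rForm_tmul_one (hγ : CoeffBraid γ) (x : FRTAlgebra γ) :
    rForm γ hγ (x ⊗ₜ 1) = Coalgebra.counit (R := k) x := by
  change rHom γ hγ x 1 = _
  induction x using induction_on with
  | hr r => simp
  | hT i p => exact (rForm_T_tmul hγ i p 1).trans ((rRow_one γ hγ i p).trans (counit_T γ i p).symm)
  | hadd x y hx hy => simpa using congr($hx + $hy)
  | hmul x y hx hy =>
    simp [LinearMap.convMul_apply, Algebra.TensorProduct.one_def, hx, hy]

lemma rHom_apply_mul (hγ : CoeffBraid γ) {α : Type*} {x : FRTAlgebra γ}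
    (𝓧 : Coalgebra.Repr k x α) (y z : FRTAlgebra γ) :
    rHom γ hγ x (y * z) =
      ∑ a ∈ 𝓧.index, rHom γ hγ (𝓧.left a) z * rHom γ hγ (𝓧.right a) y := by
  let fst := (convComp (B := k) (tensorFst k (FRTAlgebra γ) (FRTAlgebra γ))).comp (rHom γ hγ)
  let snd := (convComp (B := k) (tensorSnd k (FRTAlgebra γ) (FRTAlgebra γ))).comp (rHom γ hγ)
  have hcomm (x y : FRTAlgebra γ) : Commute (snd x) (fst y) := by
    ext u v
    refine (convMul_tensorSnd_tensorFst _ _ u v).trans ((mul_comm _ _).trans ?_)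
    exact (convMul_tensorFst_tensorSnd _ _ u v).symm
  have hmul : (convComp (Bialgebra.mulCoalgHom k (FRTAlgebra γ))).comp (rHom γ hγ) =
      convMulAlgHom snd fst hcomm := by
    refine algHom_ext fun i p => ?_
    rw [convMulAlgHom_apply _ _ _ ((isComatrix_T γ).repr i p)]
    refine WithConv.ext (TensorProduct.ext' fun u v => ?_)
    refine (rForm_T_tmul hγ i p (u * v)).trans ((rRow_mul γ hγ i p u v).trans ?_)
    simp only [WithConv.ofConv_sum, LinearMap.sum_apply]
    refine Finset.sum_congr rfl fun s _ => ?_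
    refine Eq.trans ?_ (convMul_tensorSnd_tensorFst _ _ u v).symm
    exact congr($((rForm_T_tmul hγ i s v).symm) * $((rForm_T_tmul hγ s p u).symm))
  refine congr($hmul x (y ⊗ₜ z)).trans ?_
  rw [convMulAlgHom_apply _ _ _ 𝓧]
  simp only [WithConv.ofConv_sum, LinearMap.sum_apply]
  exact Finset.sum_congr rfl fun a _ => convMul_tensorSnd_tensorFst _ _ y z

lemma isBicharacter_rForm (hγ : CoeffBraid γ) : IsBicharacter (rForm γ hγ) where
  convCurry_one := map_one (rHom γ hγ)
  convCurry_mul := map_mul (rHom γ hγ)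
  convCurryRight_one := by
    ext x
    exact rForm_tmul_one hγ x
  convCurryRight_mul y z := by
    ext x
    let 𝓧 := Coalgebra.Repr.arbitrary k x
    trans (convCurryRight (toConv (rForm γ hγ)) z * convCurryRight (toConv (rForm γ hγ)) y) x
    · rw [𝓧.convMul_apply]
      exact rHom_apply_mul hγ 𝓧 y z
    · rfl

end RForm

section Inverse

variable {B : Type*} [Semiring B] [Algebra k B] {u v : FRTAlgebra γ →ₗ[k] B}

lemma convMul_eq_one_of_map_mul_of_map_mul_rev (hu₁ : u 1 = 1) (hv₁ : v 1 = 1)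
    (hu : ∀ x y, u (x * y) = u x * u y) (hv : ∀ x y, v (x * y) = v y * v x)
    (h : ∀ i j, ∑ s, u (T γ i s) * v (T γ s j) = if i = j then 1 else 0) :
    toConv u * toConv v = 1 := by
  ext x
  induction x using induction_on with
  | hr r => exact convMul_algebraMap_eq_one hu₁ hv₁ r
  | hT i j =>
    rw [(isComatrix_T γ).convMul_apply]
    simp [h, counit_T]
  | hadd x y hx hy => simp only [map_add, hx, hy]
  | hmul x y hx hy => exact convMul_mul_eq_of_map_mul_of_map_mul_rev hu hv hx hy

lemma convMul_eq_one_of_map_mul_rev_of_map_mul (hu₁ : u 1 = 1) (hv₁ : v 1 = 1)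
    (hu : ∀ x y, u (x * y) = u y * u x) (hv : ∀ x y, v (x * y) = v x * v y)
    (h : ∀ i j, ∑ s, u (T γ i s) * v (T γ s j) = if i = j then 1 else 0) :
    toConv u * toConv v = 1 := by
  ext x
  induction x using induction_on with
  | hr r => exact convMul_algebraMap_eq_one hu₁ hv₁ r
  | hT i j =>
    rw [(isComatrix_T γ).convMul_apply]
    simp [h, counit_T]
  | hadd x y hx hy => simp only [map_add, hx, hy]
  | hmul x y hx hy => exact convMul_mul_eq_of_map_mul_rev_of_map_mul hu hv hx hy

variable {f g : FRTAlgebra γ ⊗[k] FRTAlgebra γ →ₗ[k] k}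

lemma convMul_flip_eq_one (hf : IsBicharacter f) (hg : IsBicharacter g)
    (h : ∀ i p j q, ∑ s, ∑ r, f (T γ i s ⊗ₜ T γ j r) * g (T γ r q ⊗ₜ T γ s p) =
      if j = q ∧ i = p then 1 else 0) :
    toConv f * toConv (flip g) = 1 := by
  have ht := isComatrix_T γ
  have hrow : toConv (formMatrix (T γ) f) * toConv (formMatrix (T γ) (flip g)) = 1 := by
    refine convMul_eq_one_of_map_mul_rev_of_map_mul (ht.formMatrix_one hf)
      (ht.formMatrix_flip_one hg) (ht.formMatrix_mul hf) (ht.formMatrix_flip_mul hg) fun j q => ?_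
    ext i p
    rw [Matrix.sum_apply]
    refine (Finset.sum_comm.trans (h i p j q)).trans ?_
    split_ifs <;> simp_all [Matrix.one_apply]
  apply convCurry_injective
  rw [map_mul, map_one]
  have hT (i p : ι) : convCurry (toConv f * toConv (flip g)) (T γ i p) =
      if i = p then 1 else 0 := by
    rw [← ht.toConv_formMatrix_convMul, ← ht.toConv_formMatrix_one] at hrow
    ext y
    refine congr($hrow y i p).trans ?_
    split_ifs with hip <;> simp [formMatrix_apply, counit_T, hip]
  refine convMul_eq_one_of_map_mul_of_map_mul_rev hf.convCurry_one hg.convCurryRight_one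
    hf.convCurry_mul hg.convCurryRight_mul fun i p => ?_
  rw [← hT, map_mul, ht.convMul_apply]
  rfl

end Inverse

section Exchange

lemma sandwich_algebraFormMatrix_T (hγ : CoeffBraid γ) (y : FRTAlgebra γ) :
    sandwich (algebraFormMatrix (T γ) (rForm γ hγ)) (Matrix.scalarAlgHom ι k).toLinearMap
        (Coalgebra.comul y) (.of (T γ)) =
      sandwich (Matrix.scalarAlgHom ι k).toLinearMap (algebraFormMatrix (T γ) (rForm γ hγ))
        (Coalgebra.comul y) (.of (T γ)) := by
  have ht := isComatrix_T γ
  have hR := isBicharacter_rForm hγ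
  induction y using induction_on with
  | hr r =>
    simp [Algebra.algebraMap_eq_smul_one, Algebra.TensorProduct.one_def, sandwich_tmul,
      algebraFormMatrix, ht.formMatrix_one hR]
  | hT p q =>
    ext i j
    have h := T_rel γ p i j q
    simp only [Algebra.smul_def, Algebra.commutes, mul_assoc] at h
    simp only [comul_T, map_sum, LinearMap.sum_apply, Matrix.sum_apply, sandwich_tmul]
    simpa [Matrix.mul_apply, algebraFormMatrix, formMatrix_apply, rForm_T_tmul_T,
      Algebra.ofId_apply, Matrix.scalar_apply, Matrix.diagonal_apply, Algebra.commutes, mul_assoc,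
      Finset.mul_sum] using Finset.sum_comm.trans h
  | hadd x y hx hy => simp only [map_add, LinearMap.add_apply, hx, hy]
  | hmul x y hx hy =>
    refine sandwich_comul_mul_exchange (fun x y => ?_)
      (map_mul (Matrix.scalarAlgHom ι k)) (fun x y => ?_) hx hy
    · exact (congrArg _ (ht.formMatrix_mul hR x y)).trans
        (map_mul (Algebra.ofId k (FRTAlgebra γ)).mapMatrix _ _)
    · refine (Matrix.scalar_commute_iff.2 (Matrix.ext fun i j => ?_)).symm
      exact (Algebra.commutes (rForm γ hγ (T γ i j ⊗ₜ x)) y).symm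

lemma semiconjBy_id (hγ : CoeffBraid γ) (x : FRTAlgebra γ) :
    SemiconjBy (toConv .id) ((isBicharacter_rForm hγ).mulFormHom x)
      ((isBicharacter_rForm hγ).formMulHom x) := by
  induction x using induction_on with
  | hr r =>
    rw [AlgHom.commutes, AlgHom.commutes]
    exact Algebra.commute_algebraMap_right r _
  | hT i j =>
    exact (isBicharacter_rForm hγ).semiconjBy_id_of_isComatrix (isComatrix_T γ)
      (sandwich_algebraFormMatrix_T hγ) i j
  | hadd x y hx hy => simpa only [map_add] using hx.add_right hy
  | hmul x y hx hy => simpa only [map_mul] using hx.mul_right hy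

end Exchange

section Universal
variable {δ : ι → ι → ι → ι → k}

lemma T_rel_of_coeffMatrix_mul_eq_one (h : coeffMatrix γ * coeffMatrix δ = 1) (i j p q : ι) :
    ∑ m, ∑ n, γ i j m n • (T δ m p * T δ n q) = ∑ m, ∑ n, γ m n p q • (T δ i m * T δ j n) := by
  let X : Matrix (ι × ι) (ι × ι) (FRTAlgebra δ) := .of fun x y => T δ x.1 y.1 * T δ x.2 y.2
  let E : Matrix (ι × ι) (ι × ι) k →ₐ[k] Matrix (ι × ι) (ι × ι) (FRTAlgebra δ) :=
    (Algebra.ofId k (FRTAlgebra δ)).mapMatrix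
  have hl (η : ι → ι → ι → ι → k) (i j p q : ι) : (E (coeffMatrix η) * X) (i, j) (p, q) =
      ∑ m, ∑ n, η i j m n • (T δ m p * T δ n q) := by
    simp [E, X, coeffMatrix, Matrix.mul_apply, Fintype.sum_prod_type, Algebra.ofId_apply,
      Algebra.smul_def]
  have hr (η : ι → ι → ι → ι → k) (i j p q : ι) : (X * E (coeffMatrix η)) (i, j) (p, q) =
      ∑ m, ∑ n, η m n p q • (T δ i m * T δ j n) := by
    simp [E, X, coeffMatrix, Matrix.mul_apply, Fintype.sum_prod_type, Algebra.ofId_apply,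
      Algebra.smul_def, Algebra.commutes]
  have hδ : Commute X (E (coeffMatrix δ)) := by
    ext ⟨i, j⟩ ⟨p, q⟩
    rw [hl, hr, T_rel]
  let u := Units.map E.toMonoidHom ⟨coeffMatrix δ, coeffMatrix γ, mul_eq_one_comm.1 h, h⟩
  have hγ : Commute X (E (coeffMatrix γ)) := Commute.units_inv_right (u := u) hδ
  rw [← hl, ← hr, hγ.eq]

/-- The bialgebra map `A(c) → A(c⁻¹)` fixing the generators. -/
def toInverse (h : coeffMatrix γ * coeffMatrix δ = 1) : FRTAlgebra γ →ₐc[k] FRTAlgebra δ :=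
  BialgHom.ofAlgHom (lift (T δ) (T_rel_of_coeffMatrix_mul_eq_one h))
    (algHom_ext fun i j => by simp [counit_T]) (algHom_ext fun i j => by simp [comul_T])

lemma toInverse_T (h : coeffMatrix γ * coeffMatrix δ = 1) (i j : ι) :
    toInverse h (T γ i j) = T δ i j :=
  lift_T _ _ i j

lemma isUnit_rForm (hγ : CoeffBraid γ) (hδ : CoeffBraid δ)
    (h : coeffMatrix γ * coeffMatrix δ = 1) : IsUnit (toConv (rForm γ hγ)) := by
  let φ : FRTAlgebra γ →ₗ[k] FRTAlgebra δ := toInverse h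
  let S : FRTAlgebra γ ⊗[k] FRTAlgebra γ →ₗ[k] k := rForm δ hδ ∘ₗ TensorProduct.map φ φ
  have hR := isBicharacter_rForm hγ
  have hS : IsBicharacter S := (isBicharacter_rForm hδ).comp_map (toInverse h)
  have S_T (i p j q : ι) : S (T γ i p ⊗ₜ T γ j q) = δ j i p q := by
    change rForm δ hδ (toInverse h (T γ i p) ⊗ₜ toInverse h (T γ j q)) = _
    rw [toInverse_T, toInverse_T, rForm_T_tmul_T]
  have hRS : toConv (rForm γ hγ) * toConv (Cartier.flip S) = 1 :=
    convMul_flip_eq_one hR hS fun i p j q => by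
      simp only [S_T, rForm_T_tmul_T]
      exact sum_mul_eq_of_coeffMatrix_mul_eq_one h j i q p
  have hSR : toConv S * toConv (Cartier.flip (rForm γ hγ)) = 1 :=
    convMul_flip_eq_one hS hR fun i p j q => by
      simp only [S_T, rForm_T_tmul_T]
      exact sum_mul_eq_of_coeffMatrix_mul_eq_one (mul_eq_one_comm.1 h) j i q p
  have hSR' : toConv (Cartier.flip S) * toConv (rForm γ hγ) = 1 := by
    rw [toConv_flip, ← convComp_tensorComm_toConv_flip (rForm γ hγ), ← map_mul, hSR, map_one]
  exact isUnit_iff_exists.2 ⟨_, hRS, hSR'⟩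

theorem isUniversalRForm_rForm (hγ : CoeffBraid γ) (hδ : CoeffBraid δ)
    (h : coeffMatrix γ * coeffMatrix δ = 1) : IsUniversalRForm (rForm γ hγ) where
  isUnit := isUnit_rForm hγ hδ h
  quasiComm := (isBicharacter_rForm hγ).unitComp_mul_mul'_eq (semiconjBy_id hγ)
  idMul_eq := (isBicharacter_rForm hγ).toConv_comp_idMul_eq
  mulId_eq := (isBicharacter_rForm hγ).toConv_comp_mulId_eq

end Universal

section DegreeDerivation

lemma dualHom_T (i j : ι) :
    dualHom γ (T γ i j) = if i = j then 1 + DualNumber.eps else 0 :=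
  lift_T _ _ i j

lemma fst_dualHom (x : FRTAlgebra γ) : (dualHom γ x).fst = counit (R := k) x := by
  have h : (TrivSqZeroExt.fstHom k k k).comp (dualHom γ) = Bialgebra.counitAlgHom k _ :=
    algHom_ext fun i j => by
      simp only [AlgHom.comp_apply, dualHom_T, Bialgebra.counitAlgHom_apply, counit_T]
      split_ifs <;> simp
  exact congr($h x)

lemma degDeriv_mul (x y : FRTAlgebra γ) : degDeriv γ (x * y) =
    degDeriv γ x * counit (R := k) y + counit (R := k) x * degDeriv γ y := by
  simp [degDeriv, TrivSqZeroExt.snd_mul, fst_dualHom, mul_comm, add_comm]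

lemma degDeriv_one : degDeriv γ 1 = 0 := by
  simp [degDeriv]

lemma degDeriv_T (i j : ι) : degDeriv γ (T γ i j) = if i = j then 1 else 0 := by
  simp only [degDeriv, LinearMap.comp_apply, AlgHom.toLinearMap_apply, dualHom_T]
  split_ifs <;> simp

lemma degDeriv_monomial (w : List (ι × ι)) :
    degDeriv γ (monomial γ w) = (w.length : k) * counit (R := k) (monomial γ w) := by
  induction w with
  | nil => simp [monomial, degDeriv_one]
  | cons a w ih =>
    have hcons : monomial γ (a :: w) = T γ a.1 a.2 * monomial γ w := by simp [monomial]
    rw [hcons, degDeriv_mul, ih, degDeriv_T, Bialgebra.counit_mul, counit_T]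
    push_cast [List.length_cons]
    ring

lemma isCocentral_degDeriv : IsCocentral (degDeriv γ) := by
  let l : FRTAlgebra γ →ₐ[k] DualNumber k ⊗[k] FRTAlgebra γ :=
    (Algebra.TensorProduct.rTensor _ (dualHom γ)).comp (Bialgebra.comulAlgHom k _)
  let r : FRTAlgebra γ →ₐ[k] DualNumber k ⊗[k] FRTAlgebra γ :=
    ((Algebra.TensorProduct.comm k _ _).toAlgHom.comp
      (Algebra.TensorProduct.lTensor _ (dualHom γ))).comp (Bialgebra.comulAlgHom k _)
  have hlr : l = r := algHom_ext fun i j => by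
    simp [r, comul_T, dualHom_T, ite_tmul, tmul_ite]
  let snd : DualNumber k ⊗[k] FRTAlgebra γ →ₗ[k] FRTAlgebra γ :=
    (TensorProduct.lid k _).toLinearMap ∘ₗ LinearMap.rTensor _ (TrivSqZeroExt.sndHom k k)
  intro x
  have hx := congr(snd ($hlr x))
  simpa [l, r, snd, degDeriv, ← (ℛ k x).eq] using hx

end DegreeDerivation

end FRTAlgebra

end

theorem mainTheorem10 {k V ι : Type*} [Field k] [AddCommGroup V] [Module k V]
    [Fintype ι] [DecidableEq ι] (b : Module.Basis ι k V)
    (c : Module.End k (V ⊗[k] V)) (hc : IsBraided c) :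
    (∀ i p j q, FRT.rForm b hc (FRT.T b c i p ⊗ₜ[k] FRT.T b c j q) = braidCoeff b c j i p q) ∧
    Cartier.IsUniversalRForm (FRT.rForm b hc) ∧
    (∀ w : List (ι × ι), FRT.degDeriv b c (FRT.monomial b c w) =
      (w.length : k) * FRT.counit b c (FRT.monomial b c w)) ∧
    (∀ x y : FRT b c, FRT.degDeriv b c (x * y) =
      FRT.degDeriv b c x * FRT.counit b c y + FRT.counit b c x * FRT.degDeriv b c y) ∧
    ∀ t : k, ∃ χ : FRT b c ⊗[k] FRT b c →ₗ[k] k,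
      (∀ w w' : List (ι × ι), χ (FRT.monomial b c w ⊗ₜ[k] FRT.monomial b c w') =
        t * (w.length : k) * (w'.length : k) *
          FRT.counit b c (FRT.monomial b c w * FRT.monomial b c w')) ∧
      χ = t • (LinearMap.mul' k k ∘ₗ TensorProduct.map (FRT.degDeriv b c) (FRT.degDeriv b c)) ∧
      Cartier.IsInfinitesimalRForm (FRT.rForm b hc) χ ∧
      Cartier.IsCartier (FRT.rForm b hc) χ := by
  obtain ⟨u, rfl⟩ := hc.isUnit
  have hR : Cartier.IsUniversalRForm (FRT.rForm b hc) :=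
    FRTAlgebra.isUniversalRForm_rForm _ (hc.inv.coeffBraid b)
      (coeffMatrix_braidCoeff_mul_eq_one b u.inv_mul)
  have hχ := hR.isCartier_smul_map FRTAlgebra.degDeriv_mul FRTAlgebra.isCocentral_degDeriv
  refine ⟨FRTAlgebra.rForm_T_tmul_T _, hR, FRTAlgebra.degDeriv_monomial,
    FRTAlgebra.degDeriv_mul, fun t => ⟨_, fun w w' => ?_, rfl, (hχ t).1, hχ t⟩⟩
  simp only [LinearMap.smul_apply, LinearMap.comp_apply, TensorProduct.map_tmul,
    LinearMap.mul'_apply, smul_eq_mul, FRTAlgebra.degDeriv_monomial, FRT.counit,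
    Bialgebra.counit_mul]
  ring
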